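/- Let $d\ge 2$. Let $Q$ be a rational, nondegenerate, indefinite quadratic form on $\mathbb{R}^{d+1}$ (that is, $Q(x)=x^{T}Ax$ with $A$ a symmetric matrix with rational entries, $\det A\neq 0$, and $Q$ takes both positive and negative values). Let $\|\cdot\|$ be the sup norm on $\mathbb{R}^{d+1}$, put $$\partial X=\{v\in\mathbb{R}^{d+1} : Q(v)=0,\ \|v\|=1\},\qquad X_0(\mathbb{Z})=\{x\in\mathbb{Z}^{d+1} : Q(x)=0\},$$ and give $\partial X$ the Euclidean metric of $\mathbb{R}^{d+1}$. Let $BA$ be the set of all $v\in\partial X$ for which there is a constant $c>0$ such that $$\Big\|\frac{x}{\|x\|}-v\Big\|\ \ge\ \frac{c}{\|x\|}\qquad\text{for all } x\in X_0(\mathbb{Z})\setminus\{0\}.$$ For $0<\alpha,\beta<1$ and a subset $S$ of a complete metric space $M$, two players choose alternately closed balls $B_1\supset A_1\supset B_2\supset A_2\supset\cdots$ of $M$, each with a chosen centre and a chosen radius $\rho>0$; Player $B$ chooses the $B_n$ (the first one, $B_1$, freely), Player $A$ chooses the $A_n$, and Player $A$ wins if $\bigcap_n A_n=\bigcap_n B_n\subset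 S$. In the $(\alpha,\beta)$-game the radii have to satisfy $\rho(A_n)=\alpha\rho(B_n)$ and $\rho(B_{n+1})=\beta\rho(A_n)$; in the strong $(\alpha,\beta)$-game they have to satisfy $\alpha\rho(B_n)\le\rho(A_n)\le\rho(B_n)$ and $\beta\rho(A_n)\le\rho(B_{n+1})\le\rho(A_n)$. The set $S$ is $\alpha$-winning (respectively $\alpha$-strong winning) if for every $0<\beta<1$ Player $A$ has a winning strategy in the $(\alpha,\beta)$-game (respectively in the strong $(\alpha,\beta)$-game). Then: 1. there is a constant $\alpha\in(0,1)$ depending only on $d$ such that, for every diagonal form $Q$ as above, the set $BA$ is $\alpha$-strong winning and $\alpha$-winning in $\partial X$; 2. for every form $Q$ as above there is a constant $\alpha\in(0,1)$, depending on $d$ and $Q$, such that $BA$ is $\alpha$-strong winning and $\alpha$-winning in $\partial X$. -/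

import Mathlib

/-! ### Schmidt games and their strong variant -/

/-- A closed ball of a metric space, with a chosen centre and a chosen positive radius. -/
structure GameBall (M : Type*) where
  center : M
  radius : ℝ
  radius_pos : 0 < radius

/-- The underlying set of points of a ball. -/
def GameBall.toSet {M : Type*} [MetricSpace M] (b : GameBall M) : Set M :=
  Metric.closedBall b.center b.radius

/-- A strategy of Player A: a reply to every finite sequence `B 0, …, B n` of moves of Player B.
(Player A's own earlier moves are determined by the strategy and by the moves of Player B.) -/
def StrategyA (M : Type*) : Type _ :=
  (n : ℕ) → (Fin (n + 1) → GameBall M) → GameBall M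

/-- The `n`-th move of Player A, using the strategy `σ` against the moves `B 0, B 1, …`. -/
def StrategyA.reply {M : Type*} (σ : StrategyA M) (B : ℕ → GameBall M) (n : ℕ) : GameBall M :=
  σ n (fun i => B i)

/-- Player A has a winning strategy, with target set `S`, in the game in which the players choose
alternately nested closed balls `B 0 ⊇ A 0 ⊇ B 1 ⊇ A 1 ⊇ …`. The radii have to satisfy
`ruleA (ρ (B n)) (ρ (A n))` and `ruleB (ρ (A n)) (ρ (B (n + 1)))`; the first ball `B 0` is
arbitrary. The strategy has to make legal moves as long as Player B does, and whenever Player B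
makes legal moves for ever, the intersection of the balls has to lie in `S`. -/
def PlayerAWins {M : Type*} [MetricSpace M] (ruleA ruleB : ℝ → ℝ → Prop) (S : Set M) : Prop :=
  ∃ σ : StrategyA M, ∀ B : ℕ → GameBall M,
    (∀ n : ℕ,
      (∀ k < n, (B (k + 1)).toSet ⊆ (σ.reply B k).toSet ∧
        ruleB (σ.reply B k).radius (B (k + 1)).radius) →
      (σ.reply B n).toSet ⊆ (B n).toSet ∧ ruleA (B n).radius (σ.reply B n).radius) ∧
    ((∀ k, (B (k + 1)).toSet ⊆ (σ.reply B k).toSet ∧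
        ruleB (σ.reply B k).radius (B (k + 1)).radius) →
      (⋂ n, (B n).toSet ∩ (σ.reply B n).toSet) ⊆ S)

/-- `S` is `α`-winning: for every `0 < β < 1`, Player A can win the game with the radii
`ρ (A n) = α ρ (B n)` and `ρ (B (n + 1)) = β ρ (A n)`. -/
def IsAlphaWinning {M : Type*} [MetricSpace M] (α : ℝ) (S : Set M) : Prop :=
  0 < α ∧ α < 1 ∧ ∀ β : ℝ, 0 < β → β < 1 →
    PlayerAWins (fun b a => a = α * b) (fun a b => b = β * a) S

/-- `S` is `α`-strong winning: for every `0 < β < 1`, Player A can win the game with the radii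
`α ρ (B n) ≤ ρ (A n) ≤ ρ (B n)` and `β ρ (A n) ≤ ρ (B (n + 1)) ≤ ρ (A n)`. The two upper bounds
say that balls are nested with their radii: they are automatic in a Euclidean space, but in a
bounded space the inclusion of the sets does not imply them. -/
def IsAlphaStrongWinning {M : Type*} [MetricSpace M] (α : ℝ) (S : Set M) : Prop :=
  0 < α ∧ α < 1 ∧ ∀ β : ℝ, 0 < β → β < 1 →
    PlayerAWins (fun b a => α * b ≤ a ∧ a ≤ b) (fun a b => β * a ≤ b ∧ b ≤ a) S

/-! ### Rational quadratic varieties and badly approximable vectors -/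

/-- The real quadratic form `x ↦ xᵀ A x` of a matrix `A` with rational entries. -/
noncomputable def ratForm {n : ℕ} (A : Matrix (Fin n) (Fin n) ℚ) :
    QuadraticForm ℝ (Fin n → ℝ) :=
  (A.map (fun q : ℚ => (q : ℝ))).toQuadraticForm'

/-- A real quadratic form is indefinite if it takes positive and negative values. -/
def IsIndefiniteForm {n : ℕ} (Q : QuadraticForm ℝ (Fin n → ℝ)) : Prop :=
  (∃ x, 0 < Q x) ∧ (∃ y, Q y < 0)

/-- The sup norm on `ℝⁿ` (the metric of `EuclideanSpace` is the Euclidean one). -/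
noncomputable def supNorm {n : ℕ} (x : EuclideanSpace ℝ (Fin n)) : ℝ :=
  ‖(WithLp.ofLp x : Fin n → ℝ)‖

/-- The radial projection `x ↦ x / ‖x‖` (sup norm) of `ℝⁿ ∖ {0}` onto the unit cube surface. -/
noncomputable def cubeProj {n : ℕ} (x : EuclideanSpace ℝ (Fin n)) : EuclideanSpace ℝ (Fin n) :=
  (supNorm x)⁻¹ • x

/-- The set `∂X` of the vectors `v` with `Q v = 0` and sup norm `1`. As a subtype it carries the
Euclidean metric. -/
def boundaryX {n : ℕ} (Q : QuadraticForm ℝ (Fin n → ℝ)) : Set (EuclideanSpace ℝ (Fin n)) :=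
  {v | Q (WithLp.ofLp v) = 0 ∧ supNorm v = 1}

/-- An integer vector, seen as a real vector. -/
noncomputable def intVec {n : ℕ} (z : Fin n → ℤ) : EuclideanSpace ℝ (Fin n) :=
  WithLp.toLp 2 (fun i => (z i : ℝ))

/-- The set `X_m(ℤ)` of the integer vectors `z` with `Q z = m`. -/
def levelIntPoints {n : ℕ} (Q : QuadraticForm ℝ (Fin n → ℝ)) (m : ℚ) : Set (Fin n → ℤ) :=
  {z | Q (fun i => (z i : ℝ)) = (m : ℝ)}

/-- The set of the badly `(Z, ψ)`-approximable vectors of `∂X`, as a subset of the metric space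
`∂X`. -/
def badlyApprox {n : ℕ} (Q : QuadraticForm ℝ (Fin n → ℝ)) (ψ : ℝ → ℝ) (Z : Set (Fin n → ℤ)) :
    Set (boundaryX Q) :=
  {v | ∃ c : ℝ, 0 < c ∧ ∀ z ∈ Z, z ≠ 0 →
    c * ψ (supNorm (intVec z)) ≤ supNorm (cubeProj (intVec z) - (v : EuclideanSpace ℝ (Fin n)))}

/-! The engine is a simplex lemma. Isotropic `x`, `y` satisfy Q(x - y) = -2⟪x, T y⟫ (`T` the
operator of the form), so two integer isotropic vectors of height at most c/r with directions within
2r of a common point pair to less than 1/N in absolute value, where N is a common denominator. Hence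
they pair to 0 (`simplex_lemma`). The span of all such vectors is therefore totally isotropic, of
dimension at most (d+1)/2. As d ≥ 2, there is a tangent direction at the centre orthogonal to this
span. Moving along it and correcting to second order back onto the cone gives a point of ∂X at
distance ≫ r from every line in the span (`exists_isotropic_far`). Player A recentres there. Each
integer vector is thus avoided at the first late enough round whose radius ρ satisfies height ≤ c/ρ,
and ρ is then comparable to 1/height or bounded below. The constant α = 1/(32(d+2)) serves every
symmetric form, so both claims follow at once. -/

open scoped RealInnerProductSpace

/-! ### Geometry of the light cone of a nondegenerate form. -/

section Geometry

variable {E : Type*} [NormedAddCommGroup E] [InnerProductSpace ℝ E] [FiniteDimensional ℝ E]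

/-- A totally isotropic subspace has at most half the dimension of the space, so a unit vector can
be chosen orthogonal to it and to one more given vector. -/
theorem exists_unit_orthogonal {d : ℕ} (hd : 2 ≤ d) (hE : Module.finrank ℝ E = d + 1)
    {T : E →L[ℝ] E} (hinj : Function.Injective T) (S : Set E)
    (hS : ∀ x ∈ S, ∀ y ∈ S, ⟪x, T y⟫ = 0) (a : E) :
    ∃ t : E, ‖t‖ = 1 ∧ ⟪a, t⟫ = 0 ∧ ∀ w ∈ S, ⟪w, t⟫ = 0 := by
  set W := Submodule.span ℝ S with hW
  -- Total isotropy says that `T` sends `W` into its Euclidean complement, whence 2 dim W ≤ d + 1.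
  have hle : W.map (T : E →ₗ[ℝ] E) ≤ Wᗮ := by
    rw [hW, Submodule.map_span, Submodule.span_le]
    rintro _ ⟨y, hy, rfl⟩
    rw [SetLike.mem_coe, Submodule.mem_orthogonal]
    intro u hu
    induction hu using Submodule.span_induction with
    | mem x hx => exact hS x hx y hy
    | zero => simp
    | add x z _ _ hx hz => rw [inner_add_left, hx, hz, add_zero]
    | smul c x _ hx => rw [real_inner_smul_left, hx, mul_zero]
  have h1 : Module.finrank ℝ W ≤ Module.finrank ℝ Wᗮ := by
    rw [LinearEquiv.finrank_eq (Submodule.equivMapOfInjective (T : E →ₗ[ℝ] E) hinj W)]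
    exact Submodule.finrank_mono hle
  have h2 := Submodule.finrank_add_finrank_orthogonal W
  have h3 : Module.finrank ℝ (W ⊔ Submodule.span ℝ {a} : Submodule ℝ E) ≤
      Module.finrank ℝ W + 1 :=
    (Submodule.finrank_add_le_finrank_add_finrank _ _).trans
      (Nat.add_le_add_left ((finrank_span_le_card ({a} : Set E)).trans (by simp)) _)
  have h4 := Submodule.finrank_add_finrank_orthogonal (W ⊔ Submodule.span ℝ {a})
  -- Here d ≥ 2 matters: dim W + 1 ≤ (d+3)/2 < d + 1.
  have h5 : (W ⊔ Submodule.span ℝ {a})ᗮ ≠ ⊥ := by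
    intro h
    rw [h, finrank_bot] at h4
    omega
  obtain ⟨t, ht, ht0⟩ := Submodule.exists_mem_ne_zero_of_ne_bot h5
  rw [Submodule.mem_orthogonal] at ht
  refine ⟨(‖t‖⁻¹ : ℝ) • t, by rw [norm_smul, norm_inv, norm_norm, inv_mul_cancel₀ (norm_ne_zero_iff.2 ht0)], ?_, fun w hw => ?_⟩
  · rw [real_inner_smul_right,
      ht a (Submodule.mem_sup_right (Submodule.mem_span_singleton_self a)), mul_zero]
  · rw [real_inner_smul_right,
      ht w (Submodule.mem_sup_left (Submodule.subset_span hw)), mul_zero]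

/-- An isotropic vector of norm at least `1` has an isotropic partner of bounded norm with which it
spans a hyperbolic plane. -/
theorem exists_hyperbolic_partner {T : E →L[ℝ] E} (hsymm : ∀ x y, ⟪T x, y⟫ = ⟪x, T y⟫)
    (hinj : Function.Injective T) :
    ∃ C : ℝ, 0 < C ∧ ∀ v : E, ⟪v, T v⟫ = 0 → 1 ≤ ‖v‖ →
      ∃ e : E, ⟪e, T e⟫ = 0 ∧ ⟪v, T e⟫ = 1 ∧ ‖e‖ ≤ C := by
  obtain ⟨K, hK, hT⟩ := (T : E →ₗ[ℝ] E).exists_antilipschitzWith (LinearMap.ker_eq_bot.2 hinj)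
  have hK0 : (0 : ℝ) < K := by exact_mod_cast hK
  have hlow : ∀ x, ‖x‖ ≤ K * ‖T x‖ := fun x => by
    simpa using hT.le_mul_norm_sub 0 x
  refine ⟨K * (1 + ‖T‖ * K), by positivity, fun v hv hv1 => ?_⟩
  set a := ‖T v‖ with ha
  have ha0 : 0 < a := by
    by_contra h
    have h1 := hlow v
    have h2 : K * ‖T v‖ ≤ 0 := mul_nonpos_of_nonneg_of_nonpos hK0.le (not_lt.1 h)
    linarith
  have haK : a⁻¹ ≤ K := by
    rw [inv_le_iff_one_le_mul₀ ha0]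
    exact hv1.trans (hlow v)
  set q := ⟪T v, T (T v)⟫ with hq
  have hqb : |q| ≤ ‖T‖ * a ^ 2 := by
    calc |q| ≤ ‖T v‖ * ‖T (T v)‖ := abs_real_inner_le_norm _ _
      _ ≤ ‖T v‖ * (‖T‖ * ‖T v‖) := by gcongr; exact T.le_opNorm _
      _ = ‖T‖ * a ^ 2 := by rw [← ha]; ring
  have hvTT : ⟪v, T (T v)⟫ = a ^ 2 := by
    rw [← hsymm, real_inner_self_eq_norm_sq]
  have hTvTv : ⟪T v, T v⟫ = a ^ 2 := real_inner_self_eq_norm_sq _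
  -- The first term pairs to 1 with `v`; subtracting a multiple of `v` keeps that and makes the
  -- vector isotropic.
  refine ⟨(a ^ 2)⁻¹ • T v - (q / (2 * a ^ 4)) • v, ?_, ?_, ?_⟩
  · simp only [map_sub, map_smul, inner_sub_left, inner_sub_right, real_inner_smul_left,
      real_inner_smul_right, hv, hvTT, hTvTv, ← hq]
    field_simp
    ring
  · simp only [map_sub, map_smul, inner_sub_right, real_inner_smul_right, hv, hvTT]
    field_simp
    ring
  · have h1 : ‖(a ^ 2)⁻¹ • T v‖ = a⁻¹ := by
      rw [norm_smul, Real.norm_eq_abs, abs_of_pos (by positivity), ← ha]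
      field_simp
    have h2 : ‖(q / (2 * a ^ 4)) • v‖ ≤ ‖T‖ * K * a⁻¹ := by
      rw [norm_smul, Real.norm_eq_abs, abs_div, abs_of_pos (by positivity : 0 < 2 * a ^ 4)]
      calc |q| / (2 * a ^ 4) * ‖v‖ ≤ (‖T‖ * a ^ 2) / (a ^ 4) * (K * a) := by
            gcongr
            · linarith [show 0 < a ^ 4 by positivity]
            · exact hlow v
        _ = ‖T‖ * K * a⁻¹ := by field_simp
    calc _ ≤ a⁻¹ + ‖T‖ * K * a⁻¹ := (norm_sub_le _ _).trans (by rw [h1]; gcongr)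
      _ = a⁻¹ * (1 + ‖T‖ * K) := by ring
      _ ≤ K * (1 + ‖T‖ * K) := by gcongr

/-- A tangential displacement of an isotropic vector can be corrected to an isotropic vector with
a quadratic error. -/
theorem exists_isotropic_near {T : E →L[ℝ] E} (hsymm : ∀ x y, ⟪T x, y⟫ = ⟪x, T y⟫)
    (hinj : Function.Injective T) :
    ∃ C s₀ : ℝ, 0 < C ∧ 0 < s₀ ∧ ∀ v t : E, ⟪v, T v⟫ = 0 → 1 ≤ ‖v‖ → ‖t‖ = 1 → ⟪T v, t⟫ = 0 →
      ∀ s : ℝ, 0 ≤ s → s ≤ s₀ → ∃ u : E, ⟪u, T u⟫ = 0 ∧ ‖u - (v + s • t)‖ ≤ C * s ^ 2 := by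
  obtain ⟨C, hC, hpart⟩ := exists_hyperbolic_partner hsymm hinj
  refine ⟨(‖T‖ + 1) * C, (2 * ((‖T‖ + 1) * C))⁻¹, by positivity, by positivity, ?_⟩
  intro v t hv hv1 ht hvt s hs hs0
  obtain ⟨e, he, hve, heC⟩ := hpart v hv hv1
  set b := ⟪t, T e⟫ with hb
  set q := ⟪t, T t⟫ with hq
  have hbb : |b| ≤ (‖T‖ + 1) * C := by
    calc |b| ≤ ‖t‖ * ‖T e‖ := abs_real_inner_le_norm _ _
      _ ≤ 1 * (‖T‖ * ‖e‖) := by rw [ht]; gcongr; exact T.le_opNorm _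
      _ ≤ (‖T‖ + 1) * C := by rw [one_mul]; gcongr; linarith
  have hqq : |q| ≤ ‖T‖ + 1 := by
    calc |q| ≤ ‖t‖ * ‖T t‖ := abs_real_inner_le_norm _ _
      _ ≤ ‖t‖ * (‖T‖ * ‖t‖) := by gcongr; exact T.le_opNorm _
      _ ≤ ‖T‖ + 1 := by rw [ht]; linarith
  have hsb : |s * b| ≤ 1 / 2 := by
    rw [abs_mul, abs_of_nonneg hs]
    calc s * |b| ≤ (2 * ((‖T‖ + 1) * C))⁻¹ * ((‖T‖ + 1) * C) := by gcongr
      _ = 1 / 2 := by field_simp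
  have hden : 1 ≤ 2 * (1 + s * b) := by linarith [(abs_le.1 hsb).1]
  have hden0 : 1 + s * b ≠ 0 := by intro h; rw [h] at hden; linarith
  -- Since `e` and `v` are isotropic and `t` is tangent, Q(v + st + he) = s²q + 2h(1 + sb) is linear
  -- in `h`; this is its root.
  set h := -(s ^ 2 * q) / (2 * (1 + s * b)) with hh
  have hhb : |h| ≤ s ^ 2 * (‖T‖ + 1) := by
    rw [hh, abs_div, abs_neg, abs_mul, abs_of_nonneg (sq_nonneg s),
      abs_of_pos (by linarith : 0 < 2 * (1 + s * b))]
    refine (div_le_self (by positivity) hden).trans ?_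
    gcongr
  have hvt' : ⟪v, T t⟫ = 0 := by rw [← hsymm]; exact hvt
  have htv : ⟪t, T v⟫ = 0 := by rw [real_inner_comm]; exact hvt
  have het : ⟪e, T t⟫ = b := by rw [← hsymm, real_inner_comm]
  have hev : ⟪e, T v⟫ = 1 := by rw [← hsymm, real_inner_comm]; exact hve
  refine ⟨v + s • t + h • e, ?_, ?_⟩
  · simp only [map_add, map_smul, inner_add_left, inner_add_right, real_inner_smul_left,
      real_inner_smul_right, hv, hvt', htv, het, hev, he, hve, ← hb, ← hq]
    have : h * (2 * (1 + s * b)) = -(s ^ 2 * q) := by rw [hh]; field_simp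
    linear_combination this
  · rw [add_sub_cancel_left, norm_smul, Real.norm_eq_abs]
    calc |h| * ‖e‖ ≤ (s ^ 2 * (‖T‖ + 1)) * C := by gcongr
      _ = _ := by ring

end Geometry

/-! ### Comparison of the sup norm and the Euclidean norm. -/

section SupNorm

variable {n : ℕ}

theorem supNorm_smul (a : ℝ) (x : EuclideanSpace ℝ (Fin n)) : supNorm (a • x) = |a| * supNorm x := by
  simp [supNorm, norm_smul]

theorem supNorm_nonneg (x : EuclideanSpace ℝ (Fin n)) : 0 ≤ supNorm x := norm_nonneg _

theorem abs_supNorm_sub_le (x y : EuclideanSpace ℝ (Fin n)) :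
    |supNorm x - supNorm y| ≤ supNorm (x - y) := abs_norm_sub_norm_le _ _

theorem supNorm_le_norm (x : EuclideanSpace ℝ (Fin n)) : supNorm x ≤ ‖x‖ :=
  (pi_norm_le_iff_of_nonneg (norm_nonneg _)).2 fun i => PiLp.norm_apply_le x i

theorem norm_le_mul_supNorm (x : EuclideanSpace ℝ (Fin n)) : ‖x‖ ≤ n * supNorm x := by
  have h : x = ∑ i, (x i) • EuclideanSpace.single i (1 : ℝ) := by
    ext j
    simp [Finset.sum_apply, Pi.single_apply]
  have h2 : ∀ i ∈ Finset.univ, ‖(x i) • EuclideanSpace.single i (1 : ℝ)‖ ≤ supNorm x := by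
    intro i _
    rw [norm_smul, PiLp.norm_single, norm_one, mul_one]
    exact norm_le_pi_norm (WithLp.ofLp x) i
  calc ‖x‖ = ‖∑ i, (x i) • EuclideanSpace.single i (1 : ℝ)‖ := by rw [← h]
    _ ≤ ∑ _i : Fin n, supNorm x := norm_sum_le_of_le _ h2
    _ = n * supNorm x := by simp

theorem one_le_supNorm_intVec {z : Fin n → ℤ} (hz : z ≠ 0) : 1 ≤ supNorm (intVec z) := by
  obtain ⟨i, hi⟩ := Function.ne_iff.1 hz
  have h1 : (1 : ℝ) ≤ |(z i : ℝ)| := by exact_mod_cast Int.one_le_abs hi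
  exact h1.trans (norm_le_pi_norm (WithLp.ofLp (intVec z)) i)

end SupNorm

/-! ### Points of ∂X far from a totally isotropic subspace. -/

section Points

/-- In a small ball of the projectivised light cone there is a point at distance comparable to the
radius from a given totally isotropic subspace. -/
theorem exists_isotropic_far {d : ℕ} (hd : 2 ≤ d)
    {T : EuclideanSpace ℝ (Fin (d + 1)) →L[ℝ] EuclideanSpace ℝ (Fin (d + 1))}
    (hsymm : ∀ x y, ⟪T x, y⟫ = ⟪x, T y⟫) (hinj : Function.Injective T) :
    ∃ r₀ : ℝ, 0 < r₀ ∧ ∀ v : EuclideanSpace ℝ (Fin (d + 1)), ⟪v, T v⟫ = 0 → supNorm v = 1 →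
      ∀ r : ℝ, 0 < r → r ≤ r₀ → ∀ S : Set (EuclideanSpace ℝ (Fin (d + 1))),
      (∀ x ∈ S, ∀ y ∈ S, ⟪x, T y⟫ = 0) →
      ∃ u : EuclideanSpace ℝ (Fin (d + 1)), ⟪u, T u⟫ = 0 ∧ supNorm u = 1 ∧ ‖u - v‖ ≤ r / 2 ∧
        ∀ w ∈ S, ∀ a : ℝ, r / (16 * (d + 2)) ≤ ‖u - a • w‖ := by
  obtain ⟨C, s₀, hC, hs₀, hnear⟩ := exists_isotropic_near hsymm hinj
  refine ⟨min s₀ (min (1 / 2) (1 / (4 * C))), by positivity, ?_⟩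
  intro v hv hv1 r hr hr0 S hS
  have hD : (0 : ℝ) < d + 2 := by positivity
  -- The displacement is at most 2s, and renormalising to sup norm 1 multiplies it by at most d + 2,
  -- which leaves r/2.
  set s : ℝ := r / (4 * (d + 2)) with hs
  have hspos : 0 < s := by positivity
  have hsr : s ≤ r := div_le_self hr.le (by linarith [(Nat.cast_nonneg d : (0 : ℝ) ≤ d)])
  have hs0 : s ≤ s₀ := hsr.trans (hr0.trans (min_le_left _ _))
  have hs1 : s ≤ 1 / 2 := hsr.trans (hr0.trans ((min_le_right _ _).trans (min_le_left _ _)))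
  have hs2 : C * s ^ 2 ≤ s / 4 := by
    have h : s ≤ 1 / (4 * C) := hsr.trans (hr0.trans ((min_le_right _ _).trans (min_le_right _ _)))
    rw [le_div_iff₀ (by positivity)] at h
    nlinarith
  -- The sign of `t` is chosen so that the component of `v` along `t` cannot cancel the displacement
  -- `s`.
  obtain ⟨t, ht1, htT, htS, htv⟩ : ∃ t : EuclideanSpace ℝ (Fin (d + 1)), ‖t‖ = 1 ∧
      ⟪T v, t⟫ = 0 ∧ (∀ w ∈ S, ⟪w, t⟫ = 0) ∧ 0 ≤ ⟪v, t⟫ := by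
    obtain ⟨t, ht1, htT, htS⟩ := exists_unit_orthogonal hd (by simp) hinj S hS (T v)
    rcases le_total 0 ⟪v, t⟫ with h | h
    · exact ⟨t, ht1, htT, htS, h⟩
    · refine ⟨-t, by rw [norm_neg, ht1], by rw [inner_neg_right, htT, neg_zero],
        fun w hw => by rw [inner_neg_right, htS w hw, neg_zero], ?_⟩
      rw [inner_neg_right]
      linarith
  obtain ⟨u, hu, hus⟩ := hnear v t hv (hv1 ▸ supNorm_le_norm v) ht1 htT s hspos.le hs0
  have hus' : ‖u - (v + s • t)‖ ≤ s / 4 := hus.trans hs2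
  have huv : ‖u - v‖ ≤ 2 * s := by
    calc ‖u - v‖ = ‖(u - (v + s • t)) + s • t‖ := by congr 1; abel
      _ ≤ s / 4 + s := by
        refine (norm_add_le _ _).trans (add_le_add hus' ?_)
        rw [norm_smul, ht1, mul_one, Real.norm_eq_abs, abs_of_pos hspos]
      _ ≤ 2 * s := by linarith
  have hut : s / 2 ≤ ⟪u, t⟫ := by
    have h1 : ⟪u, t⟫ = ⟪u - (v + s • t), t⟫ + (⟪v, t⟫ + s) := by
      rw [inner_sub_left, inner_add_left, real_inner_smul_left, real_inner_self_eq_norm_sq, ht1]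
      ring
    have h2 : |⟪u - (v + s • t), t⟫| ≤ s / 4 :=
      (abs_real_inner_le_norm _ _).trans (by rwa [ht1, mul_one])
    linarith [(abs_le.1 h2).1]
  set p := supNorm u with hp
  have hsupd : |p - 1| ≤ ‖u - v‖ := by
    rw [hp, ← hv1]
    exact (abs_supNorm_sub_le u v).trans (supNorm_le_norm _)
  have hp2 : p ≤ 2 := by linarith [(abs_le.1 hsupd).2]
  have hp0 : 0 < p := by
    rw [hp]
    refine lt_of_le_of_ne (supNorm_nonneg u) fun h => ?_
    have h3 := norm_le_mul_supNorm u
    rw [← h, mul_zero] at h3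
    rw [norm_eq_zero.1 (le_antisymm h3 (norm_nonneg u)), inner_zero_left] at hut
    linarith
  refine ⟨p⁻¹ • u, ?_, ?_, ?_, fun w hw a => ?_⟩
  · rw [map_smul, real_inner_smul_left, real_inner_smul_right, hu]
    simp
  · rw [supNorm_smul, abs_of_pos (by positivity), ← hp, inv_mul_cancel₀ hp0.ne']
  · have h1 : p⁻¹ • u - v = (u - v) + (p⁻¹ - 1) • u := by rw [sub_smul, one_smul]; abel
    have h2 : ‖(p⁻¹ - 1) • u‖ ≤ (d + 1) * ‖u - v‖ := by
      rw [norm_smul, Real.norm_eq_abs, show p⁻¹ - 1 = p⁻¹ * (1 - p) by field_simp, abs_mul,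
        abs_of_pos (inv_pos.2 hp0), abs_sub_comm]
      calc p⁻¹ * |p - 1| * ‖u‖ ≤ p⁻¹ * ‖u - v‖ * ((d + 1) * p) := by
            gcongr
            simpa using norm_le_mul_supNorm u
        _ = (d + 1) * ‖u - v‖ := by field_simp
    rw [h1]
    calc _ ≤ ‖u - v‖ + (d + 1) * ‖u - v‖ := (norm_add_le _ _).trans (by gcongr)
      _ = (d + 2) * ‖u - v‖ := by ring
      _ ≤ (d + 2) * (2 * s) := by gcongr
      _ = r / 2 := by rw [hs]; field_simp; ring
  -- Pairing with `t` kills every multiple of `w`, so the bound is uniform in `w` and `a`.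
  · have h1 : ⟪p⁻¹ • u - a • w, t⟫ = p⁻¹ * ⟪u, t⟫ := by
      rw [inner_sub_left, real_inner_smul_left, real_inner_smul_left, htS w hw, mul_zero, sub_zero]
    have h2 : 1 / 2 ≤ p⁻¹ := by rw [one_div]; gcongr
    calc r / (16 * (d + 2)) = 1 / 2 * (s / 2) := by rw [hs]; field_simp; ring
      _ ≤ p⁻¹ * ⟪u, t⟫ := by gcongr
      _ ≤ ‖p⁻¹ • u - a • w‖ := by
        rw [← h1]
        exact (real_inner_le_norm _ _).trans (by rw [ht1, mul_one])

end Points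

/-! ### Rational forms at integer vectors and the simplex lemma. -/

section Arithmetic

variable {n : ℕ} (A : Matrix (Fin n) (Fin n) ℚ)

/-- The operator of a rational matrix on the Euclidean space. -/
noncomputable def ratOperator : EuclideanSpace ℝ (Fin n) →L[ℝ] EuclideanSpace ℝ (Fin n) :=
  Matrix.toEuclideanCLM (𝕜 := ℝ) (A.map (fun q : ℚ => (q : ℝ)))

theorem ratForm_eq_inner (x : EuclideanSpace ℝ (Fin n)) :
    ratForm A (WithLp.ofLp x) = ⟪x, ratOperator A x⟫ := by
  rw [ratOperator, Matrix.inner_toEuclideanCLM]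
  simp [ratForm, Matrix.toQuadraticForm', Matrix.toLinearMap₂'_apply']

variable {A}

theorem ratOperator_symm (hA : A.IsSymm) (x y : EuclideanSpace ℝ (Fin n)) :
    ⟪ratOperator A x, y⟫ = ⟪x, ratOperator A y⟫ := by
  rw [real_inner_comm, ratOperator, Matrix.inner_toEuclideanCLM, Matrix.inner_toEuclideanCLM,
    Matrix.dotProduct_mulVec, dotProduct_comm, ← Matrix.mulVec_transpose,
    (hA.map _).eq]

theorem ratOperator_injective (hA : A.det ≠ 0) : Function.Injective (ratOperator A) := by
  have hdet : (A.map (fun q : ℚ => (q : ℝ))).det ≠ 0 := by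
    have h := RingHom.map_det (Rat.castHom ℝ) A
    rw [RingHom.mapMatrix_apply] at h
    have h2 : (A.map (fun q : ℚ => (q : ℝ))) = A.map (Rat.castHom ℝ) := rfl
    rw [h2, ← h]
    simpa using hA
  intro x y hxy
  have h := congrArg WithLp.ofLp hxy
  rw [ratOperator, Matrix.ofLp_toEuclideanCLM, Matrix.ofLp_toEuclideanCLM] at h
  exact WithLp.ofLp_injective 2
    (Matrix.mulVec_injective_of_isUnit ((Matrix.isUnit_iff_isUnit_det _).2 hdet.isUnit) h)

variable (A)

/-- The values of a rational bilinear form at integer vectors have bounded denominators. -/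
theorem exists_denominator :
    ∃ N : ℕ, 0 < N ∧ ∀ z w : Fin n → ℤ, ∃ k : ℤ,
      (N : ℝ) * ⟪intVec z, ratOperator A (intVec w)⟫ = k := by
  refine ⟨∏ i, ∏ j, (A i j).den, Finset.prod_pos fun i _ => Finset.prod_pos fun j _ =>
    (A i j).den_pos, fun z w => ?_⟩
  set N := ∏ i, ∏ j, (A i j).den with hN
  have hk : ∀ i j, ∃ k : ℤ, (N : ℝ) * (A i j : ℝ) = k := by
    intro i j
    obtain ⟨m, hm⟩ : (A i j).den ∣ N :=
      (Finset.dvd_prod_of_mem (fun j => (A i j).den) (Finset.mem_univ j)).trans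
        (Finset.dvd_prod_of_mem (fun i => ∏ j, (A i j).den) (Finset.mem_univ i))
    refine ⟨m * (A i j).num, ?_⟩
    have h := Rat.mul_den_eq_num (A i j)
    have h' : (A i j : ℝ) * (A i j).den = (A i j).num := by exact_mod_cast h
    rw [hm]
    push_cast
    linear_combination (m : ℝ) * h'
  choose k hk using hk
  refine ⟨∑ i, ∑ j, z i * k i j * w j, ?_⟩
  rw [ratOperator, Matrix.inner_toEuclideanCLM]
  simp only [dotProduct, Matrix.mulVec, intVec, Matrix.map_apply, Finset.mul_sum]
  push_cast
  refine Finset.sum_congr rfl fun i _ => Finset.sum_congr rfl fun j _ => ?_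
  rw [← hk]
  ring

variable {A}

theorem supNorm_smul_cubeProj {z : Fin n → ℤ} (hz : z ≠ 0) :
    supNorm (intVec z) • cubeProj (intVec z) = intVec z := by
  rw [cubeProj, smul_inv_smul₀ (by linarith [one_le_supNorm_intVec hz])]

/-- The simplex lemma: isotropic integer vectors of small height whose directions lie in a common
small ball are pairwise orthogonal with respect to the quadratic form. -/
theorem simplex_lemma (hA : A.IsSymm) :
    ∃ c : ℝ, 0 < c ∧ ∀ (v : EuclideanSpace ℝ (Fin n)) (r : ℝ), 0 < r → ∀ z w : Fin n → ℤ,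
      z ≠ 0 → w ≠ 0 → z ∈ levelIntPoints (ratForm A) 0 → w ∈ levelIntPoints (ratForm A) 0 →
      supNorm (intVec z) ≤ c / r → supNorm (intVec w) ≤ c / r →
      ‖cubeProj (intVec z) - v‖ ≤ 2 * r → ‖cubeProj (intVec w) - v‖ ≤ 2 * r →
      ⟪intVec z, ratOperator A (intVec w)⟫ = 0 := by
  obtain ⟨N, hN, hden⟩ := exists_denominator A
  set T := ratOperator A with hT
  have hN' : (1 : ℝ) ≤ N := by exact_mod_cast hN
  set c : ℝ := 1 / (8 * N * (‖T‖ + 1)) with hc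
  have hc0 : 0 < c := by positivity
  have hc1 : c ≤ 1 := by
    rw [hc, div_le_one (by positivity)]
    nlinarith [norm_nonneg T]
  have hcN : N * (8 * ‖T‖ * c ^ 2) < 1 := by
    calc N * (8 * ‖T‖ * c ^ 2) ≤ N * (8 * ‖T‖ * c) := by
          gcongr
          nlinarith
      _ = ‖T‖ / (‖T‖ + 1) := by rw [hc]; field_simp
      _ < 1 := by rw [div_lt_one (by positivity)]; linarith
  refine ⟨c, hc0, fun v r hr z w hz hw hzQ hwQ hzc hwc hzv hwv => ?_⟩
  have iso : ∀ z : Fin n → ℤ, z ∈ levelIntPoints (ratForm A) 0 →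
      ⟪cubeProj (intVec z), T (cubeProj (intVec z))⟫ = 0 := by
    intro z hz
    have h : ⟪intVec z, T (intVec z)⟫ = 0 := by
      rw [hT, ← ratForm_eq_inner]
      simpa [levelIntPoints, intVec] using hz
    rw [cubeProj, map_smul, real_inner_smul_left, real_inner_smul_right, h]
    simp
  set x := cubeProj (intVec z) with hx
  set y := cubeProj (intVec w) with hy
  have hxy : ‖x - y‖ ≤ 4 * r := by
    calc ‖x - y‖ = ‖(x - v) - (y - v)‖ := by congr 1; abel
      _ ≤ 2 * r + 2 * r := (norm_sub_le _ _).trans (add_le_add hzv hwv)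
      _ = 4 * r := by ring
  have hB : ⟪x - y, T (x - y)⟫ = -2 * ⟪x, T y⟫ := by
    have h : ⟪y, T x⟫ = ⟪x, T y⟫ := by rw [← ratOperator_symm hA, real_inner_comm]
    rw [map_sub, inner_sub_left, inner_sub_right, inner_sub_right, iso z hzQ, iso w hwQ, h]
    ring
  have hB2 : |⟪x, T y⟫| ≤ 8 * ‖T‖ * r ^ 2 := by
    have h : |⟪x - y, T (x - y)⟫| ≤ (4 * r) * (‖T‖ * (4 * r)) := by
      calc _ ≤ ‖x - y‖ * ‖T (x - y)‖ := abs_real_inner_le_norm _ _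
        _ ≤ ‖x - y‖ * (‖T‖ * ‖x - y‖) := by gcongr; exact T.le_opNorm _
        _ ≤ _ := by gcongr
    rw [hB, abs_mul, abs_neg, abs_two] at h
    linarith
  have hval : |⟪intVec z, T (intVec w)⟫| ≤ 8 * ‖T‖ * c ^ 2 := by
    rw [← supNorm_smul_cubeProj hz, ← supNorm_smul_cubeProj hw, ← hx, ← hy, map_smul,
      real_inner_smul_left, real_inner_smul_right, abs_mul, abs_mul,
      abs_of_nonneg (supNorm_nonneg _), abs_of_nonneg (supNorm_nonneg _)]
    calc _ ≤ (c / r) * ((c / r) * (8 * ‖T‖ * r ^ 2)) := by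
          have := supNorm_nonneg (intVec w)
          gcongr
      _ = 8 * ‖T‖ * c ^ 2 := by field_simp
  obtain ⟨k, hk⟩ := hden z w
  have hk1 : |(k : ℝ)| < 1 := by
    rw [← hk, abs_mul, Nat.abs_cast]
    exact (mul_le_mul_of_nonneg_left hval (by positivity)).trans_lt hcN
  have hk0 : k = 0 := by
    rw [← Int.abs_lt_one_iff]
    exact_mod_cast hk1
  rw [hk0, Int.cast_zero, mul_eq_zero] at hk
  exact hk.resolve_left (by positivity)

end Arithmetic

/-! ### Positional strategies. -/

section Game

/-- A positional strategy: the reply to `b` is the ball of centre `f b` and radius `α * ρ (b)`. -/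
def positionalStrategy {M : Type*} (α : ℝ) (hα : 0 < α) (f : GameBall M → M) : StrategyA M :=
  fun n B => ⟨f (B (Fin.last n)), α * (B (Fin.last n)).radius, mul_pos hα (B (Fin.last n)).radius_pos⟩

/-- A positional strategy that wins whenever the radii decrease geometrically at a controlled rate
wins every game whose rules allow the radius `α * ρ` and force this rate. -/
theorem playerAWins_of_positional {M : Type*} [MetricSpace M] {ruleA ruleB : ℝ → ℝ → Prop}
    {S : Set M} {α β : ℝ} (hα : 0 < α) (hruleA : ∀ b, 0 < b → ruleA b (α * b))
    (hruleB : ∀ a b, 0 < a → ruleB a b → β * a ≤ b ∧ b ≤ a) (f : GameBall M → M)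
    (hf : ∀ b, dist (f b) b.center ≤ (1 - α) * b.radius)
    (hwin : ∀ B : ℕ → GameBall M,
      (∀ n, β * (α * (B n).radius) ≤ (B (n + 1)).radius ∧
        (B (n + 1)).radius ≤ α * (B n).radius) →
      ∀ x, (∀ n, dist x (B n).center ≤ (B n).radius ∧ dist x (f (B n)) ≤ α * (B n).radius) →
        x ∈ S) :
    PlayerAWins ruleA ruleB S := by
  refine ⟨positionalStrategy α hα f, fun B => ⟨fun n _ => ⟨?_, hruleA _ (B n).radius_pos⟩,
    fun hB x hx => ?_⟩⟩
  · refine Metric.closedBall_subset_closedBall' ?_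
    have := hf (B n)
    change α * (B n).radius + dist (f (B n)) (B n).center ≤ (B n).radius
    linarith
  · exact hwin B (fun n => hruleB _ _ (mul_pos hα (B n).radius_pos) (hB n).2) x
      fun n => Set.mem_iInter.1 hx n

end Game

/-! ### The winning strategy for badly approximable vectors. -/

section Winning

variable {d : ℕ} {A : Matrix (Fin (d + 1)) (Fin (d + 1)) ℚ}

/-- In every small ball Player A can move away from all isotropic integer directions of height at
most a constant times the inverse of the radius. -/
theorem exists_centre_avoiding (hd : 2 ≤ d) (hA : A.IsSymm) (hdet : A.det ≠ 0) {α : ℝ}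
    (hα : α = 1 / (32 * (d + 2))) :
    ∃ r₀ c : ℝ, 0 < r₀ ∧ 0 < c ∧ ∀ b : GameBall (boundaryX (ratForm A)), b.radius ≤ r₀ →
      ∃ u : boundaryX (ratForm A), dist u b.center ≤ (1 - α) * b.radius ∧
        ∀ x : boundaryX (ratForm A), dist x b.center ≤ b.radius → dist x u ≤ α * b.radius →
          ∀ z ∈ levelIntPoints (ratForm A) 0, z ≠ 0 → supNorm (intVec z) ≤ c / b.radius →
            α * b.radius ≤ ‖cubeProj (intVec z) - x‖ := by
  obtain ⟨r₀, hr₀, hfar⟩ :=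
    exists_isotropic_far hd (ratOperator_symm hA) (ratOperator_injective hdet)
  obtain ⟨c, hc, hsimplex⟩ := simplex_lemma hA
  refine ⟨r₀, c, hr₀, hc, fun b hb => ?_⟩
  have hd0 : (0 : ℝ) ≤ d := Nat.cast_nonneg d
  have hα1 : α ≤ 1 / 2 := by
    rw [hα]
    exact one_div_le_one_div_of_le (by norm_num) (by linarith)
  set v : EuclideanSpace ℝ (Fin (d + 1)) := b.center.1 with hv
  set r := b.radius with hr
  have hr0 : 0 < r := b.radius_pos
  obtain ⟨u, huQ, hu1, huv, hu⟩ := hfar v (by rw [← ratForm_eq_inner]; exact b.center.2.1)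
    b.center.2.2 r hr0 hb
    {x | ∃ z ∈ levelIntPoints (ratForm A) 0, z ≠ 0 ∧ supNorm (intVec z) ≤ c / r ∧
      ‖cubeProj (intVec z) - v‖ ≤ 2 * r ∧ intVec z = x} (by
    rintro _ ⟨z, hzQ, hz, hzc, hzv, rfl⟩ _ ⟨w, hwQ, hw, hwc, hwv, rfl⟩
    exact hsimplex v r hr0 z w hz hw hzQ hwQ hzc hwc hzv hwv)
  refine ⟨⟨u, by rw [ratForm_eq_inner]; exact huQ, hu1⟩, ?_, fun x hxv hxu z hzQ hz hzc => ?_⟩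
  · rw [Subtype.dist_eq, dist_eq_norm]
    refine huv.trans ?_
    nlinarith
  · rw [Subtype.dist_eq, dist_eq_norm] at hxv hxu
    by_cases hzv : ‖cubeProj (intVec z) - v‖ ≤ 2 * r
    · have h1 : r / (16 * (d + 2)) ≤ ‖u - cubeProj (intVec z)‖ :=
        hu _ ⟨z, hzQ, hz, hzc, hzv, rfl⟩ (supNorm (intVec z))⁻¹
      have h2 : r / (16 * (d + 2)) = 2 * α * r := by rw [hα]; field_simp; ring
      have h3 : ‖u - cubeProj (intVec z)‖ ≤
          ‖(x : EuclideanSpace ℝ (Fin (d + 1))) - u‖ + ‖cubeProj (intVec z) - x‖ := by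
        rw [norm_sub_rev u]
        exact (norm_sub_le_norm_sub_add_norm_sub _ _ _).trans_eq (add_comm _ _)
      simp only at hxu
      linarith
    -- A direction farther than 2r from the centre is at least r away from every point of the ball.
    · have h3 := norm_sub_le_norm_sub_add_norm_sub (cubeProj (intVec z))
        (x : EuclideanSpace ℝ (Fin (d + 1))) v
      have h4 : α * r ≤ r := by nlinarith
      linarith

/-- Abstract rules let one strategy serve both games: only the legality of radius αρ and Player B's
shrinking factor in [β, 1] matter. -/
theorem exists_badlyApprox_strategy (hd : 2 ≤ d) (hA : A.IsSymm) (hdet : A.det ≠ 0) {α : ℝ}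
    (hα : α = 1 / (32 * (d + 2))) {β : ℝ} (hβ : 0 < β) {ruleA ruleB : ℝ → ℝ → Prop}
    (hruleA : ∀ b, 0 < b → ruleA b (α * b))
    (hruleB : ∀ a b, 0 < a → ruleB a b → β * a ≤ b ∧ b ≤ a) :
    PlayerAWins ruleA ruleB
      (badlyApprox (ratForm A) (fun t => t⁻¹) (levelIntPoints (ratForm A) 0)) := by
  obtain ⟨r₀, c, hr₀, hc, hmove⟩ := exists_centre_avoiding hd hA hdet hα
  have hα0 : 0 < α := by rw [hα]; positivity
  have hα1 : α < 1 := by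
    rw [hα, div_lt_one (by positivity)]
    linarith [(Nat.cast_nonneg d : (0 : ℝ) ≤ d)]
  choose f hf using hmove
  classical
  -- While the radius exceeds `r₀`, Player A keeps the centre and only waits for it to shrink.
  refine playerAWins_of_positional hα0 hruleA hruleB
    (fun b => if h : b.radius ≤ r₀ then f b h else b.center) (fun b => ?_) (fun B hB x hx => ?_)
  · split_ifs with h
    · exact (hf b h).1
    · rw [dist_self]
      exact mul_nonneg (by linarith) b.radius_pos.le
  set ρ : ℕ → ℝ := fun n => (B n).radius with hρ
  have hρ0 : ∀ n, 0 < ρ n := fun n => (B n).radius_pos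
  have hanti : Antitone ρ := antitone_nat_of_succ_le fun n => by
    have := (hB n).2
    have := hρ0 n
    simp only [hρ] at *
    nlinarith
  have hpow : ∀ n, ρ n ≤ ρ 0 * α ^ n := fun n => by
    induction n with
    | zero => simp
    | succ n ih =>
      calc ρ (n + 1) ≤ α * ρ n := (hB n).2
        _ ≤ α * (ρ 0 * α ^ n) := by gcongr
        _ = ρ 0 * α ^ (n + 1) := by ring
  have hsmall : ∀ ε : ℝ, 0 < ε → ∃ n, ρ n ≤ ε := fun ε hε => by
    obtain ⟨n, hn⟩ := exists_pow_lt_of_lt_one (div_pos hε (hρ0 0)) hα1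
    refine ⟨n, (hpow n).trans ?_⟩
    rw [lt_div_iff₀ (hρ0 0)] at hn
    linarith
  obtain ⟨n₀, hn₀⟩ := hsmall r₀ hr₀
  have havoid : ∀ n, n₀ ≤ n → ∀ z ∈ levelIntPoints (ratForm A) 0, z ≠ 0 →
      supNorm (intVec z) ≤ c / ρ n → α * ρ n ≤ ‖cubeProj (intVec z) - x‖ := by
    intro n hn z hzQ hz hzc
    have hr : (B n).radius ≤ r₀ := (hanti hn).trans hn₀
    have h := (hx n).2
    rw [dif_pos hr] at h
    exact (hf (B n) hr).2 x (hx n).1 h z hzQ hz hzc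
  -- The two terms cover vectors already low enough at round `n₀` and those first handled later.
  set κ := min (α * ρ n₀) (α * (β * (α * c))) with hκ
  have hκ0 : 0 < κ := lt_min (mul_pos hα0 (hρ0 n₀)) (by positivity)
  have hD : (0 : ℝ) < d + 1 := by positivity
  refine ⟨κ / (d + 1), by positivity, fun z hzQ hz => ?_⟩
  have hz1 := one_le_supNorm_intVec hz
  set p := supNorm (intVec z) with hp
  have hp0 : 0 < p := by linarith
  have key : κ * p⁻¹ ≤ ‖cubeProj (intVec z) - x‖ := by
    have hex : ∃ m, p ≤ c / ρ (n₀ + m) := by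
      obtain ⟨m, hm⟩ := hsmall (c / p) (by positivity)
      refine ⟨m, ?_⟩
      have h := (hanti (Nat.le_add_left m n₀)).trans hm
      rw [le_div_iff₀ hp0] at h
      rw [le_div_iff₀ (hρ0 _)]
      linarith
    -- At the first round that handles `z`, minimality gives c/p below the previous radius, and one
    -- round costs at most a factor αβ.
    have hmem := Nat.find_spec hex
    have hmin := fun {m} => Nat.find_min hex (m := m)
    generalize Nat.find hex = m at hmem hmin
    have hav := havoid (n₀ + m) (Nat.le_add_right _ _) z hzQ hz hmem
    cases m with
    | zero =>
      calc κ * p⁻¹ ≤ (α * ρ n₀) * 1 := by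
            gcongr
            · exact mul_nonneg hα0.le (hρ0 n₀).le
            · exact min_le_left _ _
            · exact inv_le_one_of_one_le₀ hz1
        _ ≤ _ := by rw [mul_one]; exact hav
    | succ m =>
      have hlt : c / ρ (n₀ + m) < p := not_le.1 (hmin (Nat.lt_succ_self m))
      have hcp : c * p⁻¹ ≤ ρ (n₀ + m) := by
        rw [div_lt_iff₀ (hρ0 _)] at hlt
        rw [← div_eq_mul_inv, div_le_iff₀ hp0]
        linarith
      calc κ * p⁻¹ ≤ α * (β * (α * c)) * p⁻¹ := by gcongr; exact min_le_right _ _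
        _ = α * (β * (α * (c * p⁻¹))) := by ring
        _ ≤ α * (β * (α * ρ (n₀ + m))) := by gcongr
        _ ≤ α * ρ (n₀ + (m + 1)) := by
          gcongr
          exact (hB (n₀ + m)).1
        _ ≤ _ := hav
  have hnorm := norm_le_mul_supNorm (cubeProj (intVec z) - (x : EuclideanSpace ℝ (Fin (d + 1))))
  push_cast at hnorm
  rw [div_mul_eq_mul_div, div_le_iff₀ hD]
  linarith

theorem badlyApprox_winning (hd : 2 ≤ d) (hA : A.IsSymm) (hdet : A.det ≠ 0) {α : ℝ}
    (hα : α = 1 / (32 * (d + 2))) :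
    IsAlphaStrongWinning α
        (badlyApprox (ratForm A) (fun t => t⁻¹) (levelIntPoints (ratForm A) 0)) ∧
      IsAlphaWinning α
        (badlyApprox (ratForm A) (fun t => t⁻¹) (levelIntPoints (ratForm A) 0)) := by
  have hα0 : 0 < α := by rw [hα]; positivity
  have hα1 : α < 1 := by
    rw [hα, div_lt_one (by positivity)]
    linarith [(Nat.cast_nonneg d : (0 : ℝ) ≤ d)]
  refine ⟨⟨hα0, hα1, fun β hβ _ => ?_⟩, ⟨hα0, hα1, fun β hβ hβ1 => ?_⟩⟩
  · exact exists_badlyApprox_strategy hd hA hdet hα hβ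
      (fun b hb => ⟨le_rfl, by nlinarith⟩) fun a b _ h => h
  · refine exists_badlyApprox_strategy hd hA hdet hα hβ (fun b _ => rfl) fun a b ha h => ?_
    exact ⟨h.ge, by rw [h]; nlinarith⟩

end Winning

theorem mainTheorem2 (d : ℕ) (hd : 2 ≤ d) :
    (∃ α : ℝ, 0 < α ∧ α < 1 ∧
      ∀ A : Matrix (Fin (d + 1)) (Fin (d + 1)) ℚ,
        A.IsDiag → A.det ≠ 0 → IsIndefiniteForm (ratForm A) →
        IsAlphaStrongWinning α
          (badlyApprox (ratForm A) (fun t => t⁻¹) (levelIntPoints (ratForm A) 0)) ∧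
        IsAlphaWinning α
          (badlyApprox (ratForm A) (fun t => t⁻¹) (levelIntPoints (ratForm A) 0))) ∧
    (∀ A : Matrix (Fin (d + 1)) (Fin (d + 1)) ℚ,
      A.IsSymm → A.det ≠ 0 → IsIndefiniteForm (ratForm A) →
      ∃ α : ℝ, 0 < α ∧ α < 1 ∧
        IsAlphaStrongWinning α
          (badlyApprox (ratForm A) (fun t => t⁻¹) (levelIntPoints (ratForm A) 0)) ∧
        IsAlphaWinning α
          (badlyApprox (ratForm A) (fun t => t⁻¹) (levelIntPoints (ratForm A) 0))) := by
  have h0 : (0 : ℝ) < 1 / (32 * (d + 2)) := by positivity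
  have h1 : (1 : ℝ) / (32 * (d + 2)) < 1 := by
    rw [div_lt_one (by positivity)]
    linarith [(Nat.cast_nonneg d : (0 : ℝ) ≤ d)]
  exact ⟨⟨_, h0, h1, fun A hA hdet _ => badlyApprox_winning hd hA.isSymm hdet rfl⟩,
    fun A hA hdet _ => ⟨_, h0, h1, badlyApprox_winning hd hA hdet rfl⟩⟩
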